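/- **Example 3.1.** Rings are associative with identity. For a subset $X$ of a ring $S$ put $\mathrm{r.ann}_S(X)=\{s\in S \mid xs=0 \text{ for all } x\in X\}$, and call $S$ *right zip* if every subset $X\subseteq S$ with $\mathrm{r.ann}_S(X)=\{0\}$ contains a finite subset $F\subseteq X$ with $\mathrm{r.ann}_S(F)=\{0\}$. Let $\mathbb{K}$ be any field and let $R$ be the associative unital $\mathbb{K}$-algebra presented by the generators $$A=\{a_\infty,\ a_\lambda,\ a_{0,n},\ a_{1,n},\ b_{1,n},\ b_{2,n} \mid n\ge 0,\ \lambda\in\mathbb{K}\}$$ and the relations 1. $a_{0,i}b_{1,j}=a_{0,i}b_{2,j}=a_{1,i}b_{1,j}$ for all $j\ge i\ge 0$; 2. $a_{1,i}b_{2,j}=0$ for all $j\ge i\ge 0$; 3. $a_{1,i}a_\infty=0$ and $(a_{0,i}+\lambda a_{1,i})a_\lambda=0$ for all $i\ge 0$ and all $\lambda\in\mathbb{K}$; 4. $a_\infty y=a_\lambda y=b_{k,j}y=0$ for all $j\ge 0$, $\lambda\in\mathbb{K}$, $k\in\{1,2\}$ and $y\in A$. Then $R$ is right zip, but the power series ring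 $R[[x]]$ (with $x$ a central variable) is not right zip. More precisely, the set $X=\{a_{0,i}-a_{1,i}x \mid i\ge 0\}\subseteq R[[x]]$ satisfies $\mathrm{r.ann}_{R[[x]]}(X)=\{0\}$, whereas $\mathrm{r.ann}_{R[[x]]}(F)\neq\{0\}$ for every finite subset $F\subseteq X$. -/

import Mathlib

/-- The right annihilator `{r | x * r = 0 for all x ∈ X}` of a subset `X` of a ring. -/
def rightAnn {R : Type*} [Ring R] (X : Set R) : Set R :=
  {r : R | ∀ x ∈ X, x * r = 0}

/-- A ring is right zip if every subset with zero right annihilator has a finite subset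
with zero right annihilator. -/
def IsRightZip (R : Type*) [Ring R] : Prop :=
  ∀ X : Set R, rightAnn X = {0} → ∃ F : Set R, F ⊆ X ∧ F.Finite ∧ rightAnn F = {0}

/-- The generators `a_∞`, `a_μ` (`μ ∈ K`), `a_{0,n}`, `a_{1,n}`, `b_{1,n}`, `b_{2,n}`. -/
inductive CedoGen (K : Type*) : Type _
  | aInf : CedoGen K
  | aPt (μ : K) : CedoGen K
  | a0 (n : ℕ) : CedoGen K
  | a1 (n : ℕ) : CedoGen K
  | b1 (n : ℕ) : CedoGen K
  | b2 (n : ℕ) : CedoGen K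

namespace CedoGen

/-- The generators `a_∞`, `a_μ`, `b_{1,n}`, `b_{2,n}`: those whose right multiples by all
generators vanish. -/
inductive IsTerminal {K : Type*} : CedoGen K → Prop
  | aInf : IsTerminal CedoGen.aInf
  | aPt (μ : K) : IsTerminal (CedoGen.aPt μ)
  | b1 (n : ℕ) : IsTerminal (CedoGen.b1 n)
  | b2 (n : ℕ) : IsTerminal (CedoGen.b2 n)

end CedoGen

open CedoGen in
/-- The defining relations, in the free associative unital algebra on the generators. -/
inductive CedoRel (K : Type*) [Field K] :
    FreeAlgebra K (CedoGen K) → FreeAlgebra K (CedoGen K) → Prop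
  | a0_b1_b2 (i j : ℕ) (h : i ≤ j) :
      CedoRel K (FreeAlgebra.ι K (a0 i) * FreeAlgebra.ι K (b1 j))
        (FreeAlgebra.ι K (a0 i) * FreeAlgebra.ι K (b2 j))
  | a0_b2_a1_b1 (i j : ℕ) (h : i ≤ j) :
      CedoRel K (FreeAlgebra.ι K (a0 i) * FreeAlgebra.ι K (b2 j))
        (FreeAlgebra.ι K (a1 i) * FreeAlgebra.ι K (b1 j))
  | a1_b2 (i j : ℕ) (h : i ≤ j) :
      CedoRel K (FreeAlgebra.ι K (a1 i) * FreeAlgebra.ι K (b2 j)) 0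
  | a1_aInf (i : ℕ) :
      CedoRel K (FreeAlgebra.ι K (a1 i) * FreeAlgebra.ι K aInf) 0
  | a0_a1_aPt (i : ℕ) (μ : K) :
      CedoRel K ((FreeAlgebra.ι K (a0 i) + μ • FreeAlgebra.ι K (a1 i)) *
        FreeAlgebra.ι K (aPt μ)) 0
  | terminal (z x : CedoGen K) (hz : z.IsTerminal) :
      CedoRel K (FreeAlgebra.ι K z * FreeAlgebra.ι K x) 0

/-- Cedó's algebra: the associative unital `K`-algebra presented by the generators `CedoGen K`
and the relations `CedoRel K`. -/
abbrev CedoAlgebra (K : Type*) [Field K] : Type _ := RingQuot (CedoRel K)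

/-- The image of a generator in Cedó's algebra. -/
noncomputable def CedoAlgebra.gen (K : Type*) [Field K] (g : CedoGen K) : CedoAlgebra K :=
  RingQuot.mkAlgHom K (CedoRel K) (FreeAlgebra.ι K g)

/-- The set `{a_{0,i} - a_{1,i} x | i ≥ 0}` in the power series ring `R[[x]]`, where `R` is
Cedó's algebra and `x` is a central variable. -/
noncomputable def cedoWitness (K : Type*) [Field K] : Set (PowerSeries (CedoAlgebra K)) :=
  Set.range fun i : ℕ =>
    PowerSeries.C (CedoAlgebra.gen K (CedoGen.a0 i)) -
      PowerSeries.C (CedoAlgebra.gen K (CedoGen.a1 i)) * PowerSeries.X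

/-! The relations rewrite only products ending in a terminal generator, so an element `x` has a
noncommutative polynomial part `p` in the letters, a combination `τ` of terminals, and polynomials
times letter-terminal pairs. This is made rigorous by letting the algebra act on `CedoSpace`
(`normalForm_injective`, `act_snd_snd`).

Right zip: an `x` whose `p` has nonzero constant term is left regular. Otherwise only the pairs of
coefficients of `u·a_{0,i}` and `u·a_{1,i}` in `p` matter. If `p ≠ 0`, anything killed by `x` is a
pure combination `τ`, and a nonzero `τ` forces all these pairs onto one line in `K²`
(`exists_line`). The generators `a_∞`, `a_μ` realise every line, so if none of them annihilates `X`,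
two elements of `X` have non-proportional pairs, and these two already have zero annihilator
(`eq_zero_of_det_ne_zero`).

Power series: an `f` killed by all `a_{0,i} - a_{1,i}x` satisfies `a_{0,i}f_{n+1} = a_{1,i}f_n`,
with `f_{-1} = 0`. Taking `i > j` eliminates `b_{1,j}` and `b_{2,j}`; no single `a_∞` or `a_μ`
supports a solution. Finitely many `i` are all at most some `n`, and then `b_{1,n} - b_{2,n} +
b_{2,n}x` is killed. -/

/-- The terminal generators `a_∞`, `a_μ`, `b_{1,n}`, `b_{2,n}` of Cedó's algebra. -/
inductive CedoTerm (K : Type*) : Type _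
  | aInf : CedoTerm K
  | aPt (μ : K) : CedoTerm K
  | b1 (n : ℕ) : CedoTerm K
  | b2 (n : ℕ) : CedoTerm K

/-- The letters `a_{0,n}` (as `(false, n)`) and `a_{1,n}` (as `(true, n)`). -/
abbrev CedoLetter : Type := Bool × ℕ

/-- The free algebra on the letters `a_{0,n}`, `a_{1,n}`, as a monoid algebra. -/
abbrev CedoPoly (K : Type*) [Field K] : Type _ := MonoidAlgebra K (FreeMonoid CedoLetter)

/-- The space of normal forms of Cedó's algebra: the words in the letters, the terminal
generators, and the words in the letters followed by a letter and a terminal generator. -/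
abbrev CedoSpace (K : Type*) [Field K] : Type _ :=
  CedoPoly K × (CedoTerm K →₀ K) × (CedoLetter × CedoTerm K →₀ CedoPoly K)

/-! ### The free algebra on the letters. -/

namespace CedoPoly

variable {K : Type*} [Field K]

/-- A letter as an element of the free algebra. -/
noncomputable def X (n : CedoLetter) : CedoPoly K := MonoidAlgebra.single (FreeMonoid.of n) 1

/-- The linear map `∂ₙ` taking `w * n` to `w` and killing the words that do not end in `n`. -/
noncomputable def deriv (n : CedoLetter) : CedoPoly K →ₗ[K] CedoPoly K where
  toFun p := .ofCoeff (p.coeff.comapDomain (· * FreeMonoid.of n) (mul_left_injective _).injOn)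
  map_add' p q := by ext w; simp
  map_smul' c p := by ext w; simp

@[simp]
theorem coeff_deriv (n : CedoLetter) (p : CedoPoly K) (w : FreeMonoid CedoLetter) :
    (deriv n p).coeff w = p.coeff (w * FreeMonoid.of n) := rfl

@[simp]
theorem coeff_X_mul_of_mul (n m : CedoLetter) (p : CedoPoly K) (w : FreeMonoid CedoLetter) :
    (X n * p).coeff (FreeMonoid.of m * w) = if n = m then p.coeff w else 0 := by
  induction p using MonoidAlgebra.induction_linear with
  | zero => simp
  | add f g hf hg =>
    simp only [mul_add, MonoidAlgebra.coeff_add, Finsupp.add_apply, hf, hg]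
    split_ifs <;> simp
  | single a b =>
    simp only [X, MonoidAlgebra.single_mul_single, MonoidAlgebra.coeff_single, one_mul]
    have h : FreeMonoid.of n * a = FreeMonoid.of m * w ↔ n = m ∧ a = w :=
      List.cons_eq_cons
    classical
    simp only [Finsupp.single_apply, h]
    by_cases h1 : n = m <;> simp [h1]

@[simp]
theorem coeff_X_mul_one (n : CedoLetter) (p : CedoPoly K) : (X n * p).coeff 1 = 0 := by
  induction p using MonoidAlgebra.induction_linear with
  | zero => simp
  | add f g hf hg => simp [mul_add, hf, hg]
  | single a b =>
    simp only [X, MonoidAlgebra.single_mul_single, MonoidAlgebra.coeff_single, one_mul]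
    exact Finsupp.single_eq_of_ne' (List.cons_ne_nil _ _)

/-- Prepending a letter commutes with deleting the last one, except on the empty word. -/
theorem deriv_X_mul (n m : CedoLetter) (p : CedoPoly K) :
    deriv n (X m * p) = X m * deriv n p +
      MonoidAlgebra.single 1 (if m = n then p.coeff 1 else 0) := by
  ext w
  induction w using FreeMonoid.casesOn with
  | one =>
    have := coeff_X_mul_of_mul m n p 1
    rw [mul_one] at this
    simp [this]
  | of_mul x xs =>
    have : (FreeMonoid.of x * xs : FreeMonoid CedoLetter) ≠ 1 := List.cons_ne_nil _ _
    simp [mul_assoc, this]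

@[simp]
theorem deriv_one (n : CedoLetter) : deriv n (1 : CedoPoly K) = 0 := by
  ext w
  have : w * FreeMonoid.of n ≠ 1 := by
    intro h; simpa using congrArg FreeMonoid.length h
  simp [MonoidAlgebra.one_def, this]

theorem coeff_mul_one (p q : CedoPoly K) : (p * q).coeff 1 = p.coeff 1 * q.coeff 1 := by
  have := MonoidAlgebra.coeff_mul_mul_of_uniqueMul (f := p) (g := q) (a0 := 1) (b0 := 1) (by
    intro a b _ _ h
    have h := congrArg FreeMonoid.length h
    simp only [FreeMonoid.length_mul, FreeMonoid.length_one, add_zero, Nat.add_eq_zero_iff,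
      FreeMonoid.length_eq_zero] at h
    exact h)
  rwa [mul_one] at this

/-- A nonzero element of the free algebra has a longest word. -/
theorem exists_longest {p : CedoPoly K} (hp : p ≠ 0) :
    ∃ w, p.coeff w ≠ 0 ∧ ∀ w', p.coeff w' ≠ 0 → w'.length ≤ w.length := by
  obtain ⟨w, hw, h⟩ := p.coeff.support.exists_max_image FreeMonoid.length
    (Finsupp.support_nonempty_iff.2 (by simpa using hp))
  exact ⟨w, by simpa using hw, fun w' hw' => h w' (by simpa using hw')⟩

/-- A product of nonzero elements contains a word at least as long as all words of the first
factor. -/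
theorem exists_coeff_mul_ne_zero {p q : CedoPoly K} (hp : p ≠ 0) (hq : q ≠ 0) :
    ∃ u, (p * q).coeff u ≠ 0 ∧ ∀ w, p.coeff w ≠ 0 → w.length ≤ u.length := by
  obtain ⟨a, ha, ha'⟩ := exists_longest hp
  obtain ⟨b, hb, hb'⟩ := exists_longest hq
  refine ⟨a * b, ?_, fun w hw => (ha' w hw).trans (by simp)⟩
  rw [MonoidAlgebra.coeff_mul_mul_of_uniqueMul]
  · exact mul_ne_zero ha hb
  -- Neither factor of `c * d = a * b` can exceed its maximal length, so the lengths agree and the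
  -- factorisation is unique.
  · intro c d hc hd h
    have hc := ha' c (by simpa using hc)
    have hd := hb' d (by simpa using hd)
    have hl := congrArg FreeMonoid.length h
    simp only [FreeMonoid.length_mul] at hl
    exact List.append_inj h (by change c.length = a.length; omega)

end CedoPoly

/-! ### The action on normal forms. -/

namespace CedoAlgebra

open MonoidAlgebra CedoPoly

variable {K : Type*} [Field K]

/-- The product of a letter and a terminal generator, in normal form. -/
noncomputable def letterMulTerm : CedoLetter → CedoTerm K → (CedoLetter × CedoTerm K →₀ K)
  | (false, i), .aInf => .single ((false, i), .aInf) 1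
  | (true, _), .aInf => 0
  | (false, i), .aPt μ => .single ((true, i), .aPt μ) (-μ)
  | (true, i), .aPt μ => .single ((true, i), .aPt μ) 1
  | (k, i), .b1 j => if i ≤ j then .single ((false, i), .b1 j) 1 else .single ((k, i), .b1 j) 1
  | (false, i), .b2 j =>
    if i ≤ j then .single ((false, i), .b1 j) 1 else .single ((false, i), .b2 j) 1
  | (true, i), .b2 j => if i ≤ j then 0 else .single ((true, i), .b2 j) 1

/-- Left multiplication by a letter on the span of the terminal generators. -/
noncomputable def letterMul (n : CedoLetter) :
    (CedoTerm K →₀ K) →ₗ[K] (CedoLetter × CedoTerm K →₀ K) :=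
  Finsupp.linearCombination K (letterMulTerm n)

@[simp]
theorem letterMul_single (n : CedoLetter) (t : CedoTerm K) (c : K) :
    letterMul n (Finsupp.single t c) = c • letterMulTerm n t := by
  simp [letterMul]

/-- The action of a letter on normal forms. -/
noncomputable def letterOp (n : CedoLetter) : Module.End K (CedoSpace K) :=
  ((LinearMap.mulLeft K (X n)).comp (LinearMap.fst K _ _)).prod <|
    LinearMap.prod 0 <|
      (Finsupp.mapRange.linearMap (LinearMap.mulLeft K (X n))).comp
          ((LinearMap.snd K _ _).comp (LinearMap.snd K _ _)) +
        (Finsupp.mapRange.linearMap (Algebra.linearMap K (CedoPoly K))).comp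
          ((letterMul n).comp ((LinearMap.fst K _ _).comp (LinearMap.snd K _ _)))

/-- The action of a terminal generator on normal forms. -/
noncomputable def termOp (t : CedoTerm K) : Module.End K (CedoSpace K) :=
  LinearMap.prod 0 <| LinearMap.prod
    ((Finsupp.lsingle t).comp <|
      ((Finsupp.lapply 1).comp (MonoidAlgebra.coeffLinearEquiv K).toLinearMap).comp
        (LinearMap.fst K _ _)) 0

@[simp] theorem letterOp_fst (n : CedoLetter) (v : CedoSpace K) :
    (letterOp n v).1 = X n * v.1 := rfl

@[simp] theorem letterOp_snd_fst (n : CedoLetter) (v : CedoSpace K) :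
    (letterOp n v).2.1 = 0 := rfl

@[simp] theorem letterOp_snd_snd (n : CedoLetter) (v : CedoSpace K)
    (q : CedoLetter × CedoTerm K) :
    (letterOp n v).2.2 q = X n * v.2.2 q + algebraMap K (CedoPoly K) (letterMul n v.2.1 q) := rfl

@[simp] theorem termOp_fst (t : CedoTerm K) (v : CedoSpace K) : (termOp t v).1 = 0 := rfl

@[simp] theorem termOp_snd_fst (t : CedoTerm K) (v : CedoSpace K) :
    (termOp t v).2.1 = Finsupp.single t (v.1.coeff 1) := rfl

@[simp] theorem termOp_snd_snd (t : CedoTerm K) (v : CedoSpace K) : (termOp t v).2.2 = 0 := rfl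

/-- The action of a generator on normal forms. -/
noncomputable def genOp : CedoGen K → Module.End K (CedoSpace K)
  | .aInf => termOp .aInf
  | .aPt μ => termOp (.aPt μ)
  | .a0 n => letterOp (false, n)
  | .a1 n => letterOp (true, n)
  | .b1 n => termOp (.b1 n)
  | .b2 n => termOp (.b2 n)

theorem letterOp_termOp (n : CedoLetter) (t : CedoTerm K) (v : CedoSpace K) :
    letterOp n (termOp t v) =
      (0, 0, Finsupp.mapRange.linearMap (Algebra.linearMap K (CedoPoly K))
        (v.1.coeff 1 • letterMulTerm n t)) := by
  refine Prod.ext ?_ (Prod.ext ?_ ?_)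
  · simp
  · simp
  · ext1 q
    simp

theorem termOp_mul_genOp (t : CedoTerm K) (g : CedoGen K) : termOp t * genOp g = 0 := by
  refine LinearMap.ext fun v => Prod.ext ?_ (Prod.ext ?_ ?_)
  · simp
  · cases g <;> simp [genOp]
  · simp

/-- After a terminal operator only a multiple of one terminal remains, so each letter-terminal
relation reduces to an identity between values of `letterMulTerm`. -/
theorem genOp_rel ⦃x y : FreeAlgebra K (CedoGen K)⦄ (h : CedoRel K x y) :
    FreeAlgebra.lift K genOp x = FreeAlgebra.lift K genOp y := by
  induction h with
  | a0_b1_b2 i j h | a0_b2_a1_b1 i j h | a1_b2 i j h =>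
    simp only [map_mul, FreeAlgebra.lift_ι_apply, genOp, map_zero]
    exact LinearMap.ext fun v => by
      simp [Module.End.mul_apply, letterOp_termOp, letterMulTerm, h]
  | a1_aInf i =>
    simp only [map_mul, FreeAlgebra.lift_ι_apply, genOp, map_zero]
    exact LinearMap.ext fun v => by simp [Module.End.mul_apply, letterOp_termOp, letterMulTerm]
  | a0_a1_aPt i μ =>
    simp only [map_mul, map_add, map_smul, FreeAlgebra.lift_ι_apply, genOp, map_zero]
    refine LinearMap.ext fun v => ?_
    rw [add_mul, smul_mul_assoc, LinearMap.add_apply, LinearMap.smul_apply, Module.End.mul_apply,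
      Module.End.mul_apply, letterOp_termOp, letterOp_termOp]
    have h : letterMulTerm (false, i) (.aPt μ) = -μ • letterMulTerm (true, i) (.aPt μ) := by
      simp [letterMulTerm]
    rw [h, smul_comm, map_smul]
    simp
  | terminal z x hz =>
    simp only [map_mul, FreeAlgebra.lift_ι_apply, map_zero]
    cases hz <;> exact termOp_mul_genOp _ _

/-- The action of Cedó's algebra on normal forms. -/
noncomputable def act : CedoAlgebra K →ₐ[K] Module.End K (CedoSpace K) :=
  RingQuot.liftAlgHom K ⟨FreeAlgebra.lift K genOp, genOp_rel⟩

@[simp]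
theorem act_gen (g : CedoGen K) : act (gen K g) = genOp g := by
  simp [act, gen]

/-- A letter as a generator. -/
noncomputable def letter : CedoLetter → CedoAlgebra K
  | (false, n) => gen K (.a0 n)
  | (true, n) => gen K (.a1 n)

/-- A terminal generator, as an element of the algebra. -/
noncomputable def term : CedoTerm K → CedoAlgebra K
  | .aInf => gen K .aInf
  | .aPt μ => gen K (.aPt μ)
  | .b1 n => gen K (.b1 n)
  | .b2 n => gen K (.b2 n)

@[simp] theorem act_letter (n : CedoLetter) : act (letter (K := K) n) = letterOp n := by
  rcases n with ⟨_ | _, n⟩ <;> simp [letter, genOp]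

@[simp] theorem act_term (t : CedoTerm K) : act (term t) = termOp t := by
  cases t <;> simp [term, genOp]

theorem gen_eq (g : CedoGen K) : (∃ n, gen K g = letter n) ∨ ∃ t, gen K g = term t := by
  cases g with
  | aInf => exact .inr ⟨.aInf, rfl⟩
  | aPt μ => exact .inr ⟨.aPt μ, rfl⟩
  | a0 n => exact .inl ⟨(false, n), rfl⟩
  | a1 n => exact .inl ⟨(true, n), rfl⟩
  | b1 n => exact .inr ⟨.b1 n, rfl⟩
  | b2 n => exact .inr ⟨.b2 n, rfl⟩

/-- Induction on elements of Cedó's algebra, multiplying by generators on the left. -/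
theorem induction_left {motive : CedoAlgebra K → Prop} (one : motive 1)
    (add : ∀ x y, motive x → motive y → motive (x + y))
    (smul : ∀ (c : K) x, motive x → motive (c • x))
    (letter_mul : ∀ n x, motive x → motive (letter n * x))
    (term_mul : ∀ t x, motive x → motive (term t * x)) (x : CedoAlgebra K) : motive x := by
  obtain ⟨x, rfl⟩ := RingQuot.mkAlgHom_surjective K (CedoRel K) x
  -- With an arbitrary right factor `y`, the product case peels off one factor at a time.
  suffices ∀ y, motive y → motive (RingQuot.mkAlgHom K (CedoRel K) x * y) by
    simpa using this 1 one
  induction x using FreeAlgebra.induction with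
  | grade0 c =>
    intro y hy
    rw [AlgHom.commutes, ← Algebra.smul_def]
    exact smul c y hy
  | grade1 g =>
    intro y hy
    change motive (gen K g * y)
    obtain ⟨n, h⟩ | ⟨t, h⟩ := gen_eq g
    · exact h ▸ letter_mul n y hy
    · exact h ▸ term_mul t y hy
  | mul a b ha hb =>
    intro y hy
    rw [map_mul, mul_assoc]
    exact ha _ (hb _ hy)
  | add a b ha hb =>
    intro y hy
    rw [map_add, add_mul]
    exact add _ _ (ha _ hy) (hb _ hy)

theorem term_mul_gen (t : CedoTerm K) (g : CedoGen K) : term t * gen K g = 0 := by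
  have key (z : CedoGen K) (hz : z.IsTerminal) : gen K z * gen K g = 0 := by
    simpa [gen] using RingQuot.mkAlgHom_rel K (CedoRel.terminal z g hz)
  cases t with
  | aInf => exact key _ .aInf
  | aPt μ => exact key _ (.aPt μ)
  | b1 n => exact key _ (.b1 n)
  | b2 n => exact key _ (.b2 n)

@[simp] theorem term_mul_letter (t : CedoTerm K) (n : CedoLetter) : term t * letter n = 0 := by
  rcases n with ⟨_ | _, n⟩ <;> exact term_mul_gen _ _

@[simp] theorem term_mul_term (t t' : CedoTerm K) : term t * term t' = 0 := by
  cases t' <;> exact term_mul_gen _ _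

/-! ### From normal forms back to the algebra. -/

/-- The inclusion of the free algebra on the letters. -/
noncomputable def polyHom : CedoPoly K →ₐ[K] CedoAlgebra K :=
  MonoidAlgebra.lift K (CedoAlgebra K) (FreeMonoid CedoLetter) (FreeMonoid.lift letter)

@[simp] theorem polyHom_X (n : CedoLetter) : polyHom (X n : CedoPoly K) = letter n := by
  simp [polyHom, X]

theorem term_mul_polyHom (t : CedoTerm K) (p : CedoPoly K) :
    term t * polyHom p = p.coeff 1 • term t := by
  induction p using MonoidAlgebra.induction_linear with
  | zero => simp
  | add f g hf hg => simp [mul_add, hf, hg, add_smul]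
  | single a b =>
    induction a using FreeMonoid.casesOn with
    | one => simp [polyHom]
    | of_mul x xs =>
      have : (FreeMonoid.of x * xs : FreeMonoid CedoLetter) ≠ 1 := List.cons_ne_nil _ _
      simp [polyHom, this, ← mul_assoc]

/-- The element represented by a normal form. -/
noncomputable def ofSpace : CedoSpace K →ₗ[K] CedoAlgebra K :=
  polyHom.toLinearMap.coprod <| (Finsupp.linearCombination K term).coprod <|
    Finsupp.lsum K fun q => (LinearMap.mulRight K (letter q.1 * term q.2)).comp polyHom.toLinearMap

theorem letter_mul_term (n : CedoLetter) (t : CedoTerm K) :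
    letter n * term t =
      Finsupp.linearCombination K (fun q => letter q.1 * term q.2) (letterMulTerm n t) := by
  have h1 (i j : ℕ) (h : i ≤ j) := RingQuot.mkAlgHom_rel K (CedoRel.a0_b1_b2 (K := K) i j h)
  have h2 (i j : ℕ) (h : i ≤ j) := RingQuot.mkAlgHom_rel K (CedoRel.a0_b2_a1_b1 (K := K) i j h)
  have h3 (i j : ℕ) (h : i ≤ j) := RingQuot.mkAlgHom_rel K (CedoRel.a1_b2 (K := K) i j h)
  have h4 (i : ℕ) := RingQuot.mkAlgHom_rel K (CedoRel.a1_aInf (K := K) i)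
  have h5 (i : ℕ) (μ : K) := RingQuot.mkAlgHom_rel K (CedoRel.a0_a1_aPt i μ)
  simp only [map_mul, map_add, map_smul, map_zero] at h1 h2 h3 h4 h5
  rcases n with ⟨_ | _, i⟩ <;> cases t <;> simp only [letterMulTerm, letter, term, gen] <;>
    (try split_ifs with hij) <;>
    simp [*]
  rename_i μ
  have := h5 i μ
  rw [add_mul, smul_mul_assoc] at this
  exact eq_neg_of_add_eq_zero_left this

theorem ofSpace_apply (v : CedoSpace K) :
    ofSpace v = polyHom v.1 + (Finsupp.linearCombination K term v.2.1 +
      Finsupp.lsum K (fun q => (LinearMap.mulRight K (letter q.1 * term q.2)).comp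
        polyHom.toLinearMap) v.2.2) := rfl

theorem ofSpace_letterOp (n : CedoLetter) (v : CedoSpace K) :
    ofSpace (letterOp n v) = letter n * ofSpace v := by
  set Φ := Finsupp.lsum K fun q : CedoLetter × CedoTerm K =>
    (LinearMap.mulRight K (letter q.1 * term q.2)).comp (polyHom (K := K)).toLinearMap with hΦ
  have h1 : Φ.comp (Finsupp.mapRange.linearMap (LinearMap.mulLeft K (X n))) =
      (LinearMap.mulLeft K (letter n)).comp Φ := by
    refine Finsupp.lhom_ext fun q p => ?_
    simp only [LinearMap.comp_apply, Finsupp.mapRange.linearMap_apply, Finsupp.mapRange_single, hΦ,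
      Finsupp.lsum_single, AlgHom.toLinearMap_apply, LinearMap.mulLeft_apply, map_mul, polyHom_X,
      LinearMap.mulRight_apply, mul_assoc]
  have h2 : Φ.comp (Finsupp.mapRange.linearMap (Algebra.linearMap K (CedoPoly K))) =
      Finsupp.linearCombination K fun q => letter q.1 * term q.2 := by
    refine Finsupp.lhom_ext fun q c => ?_
    simp only [LinearMap.comp_apply, Finsupp.mapRange.linearMap_apply, Finsupp.mapRange_single, hΦ,
      Finsupp.lsum_single, Algebra.linearMap_apply, AlgHom.toLinearMap_apply, AlgHom.commutes,
      LinearMap.mulRight_apply, Finsupp.linearCombination_single, Algebra.smul_def]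
  have h3 : (Finsupp.linearCombination K fun q : CedoLetter × CedoTerm K =>
      letter q.1 * term q.2).comp (letterMul n) =
      (LinearMap.mulLeft K (letter n)).comp (Finsupp.linearCombination K term) := by
    refine Finsupp.lhom_ext fun t c => ?_
    simp [letter_mul_term n]
  have h4 : (letterOp n v).2.2 =
      Finsupp.mapRange.linearMap (LinearMap.mulLeft K (X n)) v.2.2 +
        Finsupp.mapRange.linearMap (Algebra.linearMap K (CedoPoly K)) (letterMul n v.2.1) := rfl
  rw [ofSpace_apply, ofSpace_apply, ← hΦ, h4, map_add, ← LinearMap.comp_apply Φ,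
    ← LinearMap.comp_apply Φ, h1, h2, ← LinearMap.comp_apply _ (letterMul n), h3]
  simp [mul_add, add_comm]

theorem ofSpace_termOp (t : CedoTerm K) (v : CedoSpace K) :
    ofSpace (termOp t v) = term t * ofSpace v := by
  have h1 : (LinearMap.mulLeft K (term t)).comp (Finsupp.linearCombination K term) = 0 :=
    Finsupp.lhom_ext fun q p => by simp
  have h2 : (LinearMap.mulLeft K (term t)).comp
      (Finsupp.lsum K fun q : CedoLetter × CedoTerm K =>
        (LinearMap.mulRight K (letter q.1 * term q.2)).comp (polyHom (K := K)).toLinearMap) = 0 :=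
    Finsupp.lhom_ext fun q p => by
      simp [← mul_assoc, term_mul_polyHom]
  have h1 := congrArg (· v.2.1) h1
  have h2 := congrArg (· v.2.2) h2
  simp only [LinearMap.comp_apply, LinearMap.mulLeft_apply, LinearMap.zero_apply] at h1 h2
  rw [ofSpace_apply, ofSpace_apply, mul_add, mul_add, h1, h2, term_mul_polyHom]
  simp

theorem ofSpace_act (x : CedoAlgebra K) (v : CedoSpace K) :
    ofSpace (act x v) = x * ofSpace v := by
  induction x using induction_left with
  | one => simp
  | add x y hx hy => simp [hx, hy, add_mul]
  | smul c x hx => simp [hx]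
  | letter_mul n x hx => simp [ofSpace_letterOp, hx, mul_assoc]
  | term_mul t x hx => simp [ofSpace_termOp, hx, mul_assoc]

/-- The normal form of an element of Cedó's algebra. -/
noncomputable def normalForm (x : CedoAlgebra K) : CedoSpace K := act x (1, 0, 0)

/-- `ofSpace` commutes with the action and sends `(1, 0, 0)` to `1`, so it is a left inverse.
Surjectivity fails, since coordinates such as `((true, i), .aInf)` are never reached, but is not
needed. -/
theorem normalForm_injective : Function.Injective (normalForm (K := K)) := by
  refine Function.LeftInverse.injective (g := ofSpace) fun x => ?_
  rw [normalForm, ofSpace_act]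
  simp [ofSpace]

@[simp] theorem normalForm_one : normalForm (1 : CedoAlgebra K) = (1, 0, 0) := by
  simp [normalForm]

@[simp] theorem normalForm_zero : normalForm (0 : CedoAlgebra K) = 0 := by simp [normalForm]

@[simp] theorem normalForm_add (x y : CedoAlgebra K) :
    normalForm (x + y) = normalForm x + normalForm y := by simp [normalForm]

@[simp] theorem normalForm_smul (c : K) (x : CedoAlgebra K) :
    normalForm (c • x) = c • normalForm x := by simp [normalForm]

theorem normalForm_mul (x y : CedoAlgebra K) : normalForm (x * y) = act x (normalForm y) := by
  simp [normalForm]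

@[simp] theorem normalForm_letter_mul (n : CedoLetter) (x : CedoAlgebra K) :
    normalForm (letter n * x) = letterOp n (normalForm x) := by simp [normalForm_mul]

@[simp] theorem normalForm_term_mul (t : CedoTerm K) (x : CedoAlgebra K) :
    normalForm (term t * x) = termOp t (normalForm x) := by simp [normalForm_mul]

theorem normalForm_term (t : CedoTerm K) : normalForm (term t) = (0, Finsupp.single t 1, 0) := by
  rw [← mul_one (term t), normalForm_term_mul]
  refine Prod.ext ?_ (Prod.ext ?_ ?_) <;> simp [MonoidAlgebra.one_def]

theorem term_ne_zero (t : CedoTerm K) : term t ≠ 0 := by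
  intro h
  have := congrArg (fun x => (normalForm x).2.1 t) h
  simp [normalForm_term] at this

theorem normalForm_eq_zero {x : CedoAlgebra K} : normalForm x = 0 ↔ x = 0 := by
  rw [← normalForm_zero, normalForm_injective.eq_iff]

/-- Only letters with the index of `q.1` contribute to the coordinate `q`. -/
theorem letterMul_apply_eq_zero (n : CedoLetter) (τ : CedoTerm K →₀ K)
    (q : CedoLetter × CedoTerm K) (h : n.2 ≠ q.1.2) : letterMul n τ q = 0 := by
  suffices (Finsupp.lapply q).comp (letterMul n) = 0 from congrArg (· τ) this
  refine Finsupp.lhom_ext fun t c => ?_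
  have key (k : Bool) (t' : CedoTerm K) (d : K) : (Finsupp.single ((k, n.2), t') d) q = 0 :=
    Finsupp.single_eq_of_ne' fun e => h (by rw [← e])
  rcases n with ⟨_ | _, i⟩ <;> cases t <;> simp only [LinearMap.comp_apply, letterMul_single,
    Finsupp.lapply_apply, Finsupp.smul_apply, letterMulTerm, LinearMap.zero_apply] <;>
    (try split_ifs) <;> simp [key]

/-! ### Coordinates of a product. -/

theorem act_fst (x : CedoAlgebra K) (v : CedoSpace K) :
    (act x v).1 = (normalForm x).1 * v.1 := by
  induction x using induction_left with
  | one => simp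
  | add x y hx hy => simp [hx, hy, add_mul]
  | smul c x hx => simp [hx]
  | letter_mul n x hx => simp [hx, mul_assoc]
  | term_mul t x hx => simp

theorem act_snd_fst (x : CedoAlgebra K) (v : CedoSpace K) :
    (act x v).2.1 =
      (normalForm x).1.coeff 1 • v.2.1 + v.1.coeff 1 • (normalForm x).2.1 := by
  induction x using induction_left with
  | one => simp [MonoidAlgebra.one_def]
  | add x y hx hy => simp only [map_add, LinearMap.add_apply, Prod.snd_add, Prod.fst_add, hx, hy,
      normalForm_add, coeff_add, Finsupp.add_apply]; module
  | smul c x hx => simp only [map_smul, LinearMap.smul_apply, Prod.smul_snd, Prod.smul_fst, hx,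
      normalForm_smul, coeff_smul, Finsupp.smul_apply]; module
  | letter_mul n x hx => simp
  | term_mul t x hx => simp [act_fst, coeff_mul_one, mul_comm]

/-- The middle sum is `p·τ`: the last letter of each word of `p` is absorbed into the terminal,
leaving a derivative of `p`. Only the two letters with the index of `q` can reach coordinate `q`. In
the last summand, terminals on the left see only the constant term. -/
theorem act_snd_snd (x : CedoAlgebra K) (v : CedoSpace K) (q : CedoLetter × CedoTerm K) :
    (act x v).2.2 q = (normalForm x).1 * v.2.2 q +
      ∑ k : Bool, letterMul (k, q.1.2) v.2.1 q • deriv (k, q.1.2) (normalForm x).1 +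
      v.1.coeff 1 • (normalForm x).2.2 q := by
  simp only [Fintype.sum_bool]
  induction x using induction_left with
  | one => simp
  | add x y hx hy =>
    simp only [map_add, LinearMap.add_apply, Prod.snd_add, Prod.fst_add, Finsupp.add_apply, hx, hy,
      normalForm_add, add_mul]
    module
  | smul c x hx =>
    simp only [map_smul, LinearMap.smul_apply, Prod.smul_snd, Prod.smul_fst, Finsupp.smul_apply, hx,
      normalForm_smul, smul_mul_assoc]
    module
  | letter_mul n x hx =>
    have h1 : (letterMul n (act x v).2.1) q = (normalForm x).1.coeff 1 * letterMul n v.2.1 q +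
        v.1.coeff 1 * letterMul n (normalForm x).2.1 q := by simp [act_snd_fst]
    rw [map_mul, Module.End.mul_apply, act_letter, letterOp_snd_snd, hx, h1, normalForm_letter_mul,
      letterOp_fst, letterOp_snd_snd, deriv_X_mul, deriv_X_mul]
    have key : algebraMap K (CedoPoly K) ((normalForm x).1.coeff 1 * letterMul n v.2.1 q) =
        letterMul (true, q.1.2) v.2.1 q •
          single 1 (if n = (true, q.1.2) then (normalForm x).1.coeff 1 else 0) +
        letterMul (false, q.1.2) v.2.1 q •
          single 1 (if n = (false, q.1.2) then (normalForm x).1.coeff 1 else 0) := by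
      by_cases hn : n.2 = q.1.2
      · rcases n with ⟨_ | _, i⟩ <;> simp only at hn <;> subst hn <;> simp [mul_comm]
      · have h2 (k : Bool) : n ≠ (k, q.1.2) := fun e => hn (by rw [e])
        simp [letterMul_apply_eq_zero n _ q hn, h2]
    rw [map_add, key]
    simp only [mul_add, smul_add, mul_smul_comm, mul_assoc, map_mul, ← Algebra.smul_def]
    abel
  | term_mul t x hx => simp

/-! ### Coordinates of a letter times a combination of terminals. -/

theorem letterMul_aInf (k : Bool) (i : ℕ) (τ : CedoTerm K →₀ K) :
    letterMul (k, i) τ ((false, i), .aInf) = if k then 0 else τ .aInf := by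
  classical
  induction τ using Finsupp.induction_linear with
  | zero => simp
  | add f g hf hg => cases k <;> simp_all
  | single t c =>
    cases k <;> cases t <;> simp [letterMulTerm] <;> split_ifs <;> simp

theorem letterMul_aPt (k : Bool) (i : ℕ) (μ : K) (τ : CedoTerm K →₀ K) :
    letterMul (k, i) τ ((true, i), .aPt μ) = if k then τ (.aPt μ) else -μ * τ (.aPt μ) := by
  classical
  induction τ using Finsupp.induction_linear with
  | zero => simp
  | add f g hf hg => cases k <;> simp_all [mul_add]
  | single t c =>
    cases k <;> cases t <;> simp [letterMulTerm, Finsupp.single_apply] <;> split_ifs <;>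
      simp_all [mul_comm]

theorem letterMul_b1_of_le (k : Bool) {i j : ℕ} (h : i ≤ j) (τ : CedoTerm K →₀ K) :
    letterMul (k, i) τ ((false, i), .b1 j) =
      if k then τ (.b1 j) else τ (.b1 j) + τ (.b2 j) := by
  classical
  induction τ using Finsupp.induction_linear with
  | zero => simp
  | add f g hf hg => cases k <;> simp_all [add_add_add_comm]
  | single t c =>
    cases k <;> cases t <;> simp [letterMulTerm, Finsupp.single_apply] <;> split_ifs <;>
      simp_all

theorem letterMul_b1_of_lt (k k' : Bool) {i j : ℕ} (h : j < i) (τ : CedoTerm K →₀ K) :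
    letterMul (k, i) τ ((k', i), .b1 j) = if k = k' then τ (.b1 j) else 0 := by
  classical
  induction τ using Finsupp.induction_linear with
  | zero => simp
  | add f g hf hg => cases k <;> cases k' <;> simp_all
  | single t c =>
    cases k <;> cases k' <;> cases t <;>
      simp [letterMulTerm, Finsupp.single_apply] <;> grind

theorem letterMul_b2_of_lt (k k' : Bool) {i j : ℕ} (h : j < i) (τ : CedoTerm K →₀ K) :
    letterMul (k, i) τ ((k', i), .b2 j) = if k = k' then τ (.b2 j) else 0 := by
  classical
  induction τ using Finsupp.induction_linear with
  | zero => simp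
  | add f g hf hg => cases k <;> cases k' <;> simp_all
  | single t c =>
    cases k <;> cases k' <;> cases t <;>
      simp [letterMulTerm, Finsupp.single_apply] <;> grind

/-! ### Annihilators and the zip property. -/

theorem mul_term_eq_zero {x : CedoAlgebra K} {t : CedoTerm K} (h : (normalForm x).1.coeff 1 = 0)
    (h' : ∀ q : CedoLetter × CedoTerm K, ∑ k : Bool, letterMulTerm (k, q.1.2) t q •
      deriv (k, q.1.2) (normalForm x).1 = 0) : x * term t = 0 := by
  rw [← normalForm_eq_zero, normalForm_mul, normalForm_term]
  refine Prod.ext ?_ (Prod.ext ?_ (Finsupp.ext fun q => ?_))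
  · simp [act_fst]
  · simp [act_snd_fst, h]
  · rw [act_snd_snd]
    simpa using h' q

theorem mul_aInf_eq_zero {x : CedoAlgebra K} (h : (normalForm x).1.coeff 1 = 0)
    (h' : ∀ u i, (normalForm x).1.coeff (u * FreeMonoid.of (false, i)) = 0) :
    x * term .aInf = 0 := by
  refine mul_term_eq_zero h fun q => ?_
  have : deriv (false, q.1.2) (normalForm x).1 = 0 := by
    ext u
    simp [h']
  simp [this, letterMulTerm]

/-- Since `a_{0,i}a_μ = -μ a_{1,i}a_μ`, the contributions of the two last letters cancel. -/
theorem mul_aPt_eq_zero {x : CedoAlgebra K} {μ : K} (h : (normalForm x).1.coeff 1 = 0)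
    (h' : ∀ u i, (normalForm x).1.coeff (u * FreeMonoid.of (true, i)) =
      μ * (normalForm x).1.coeff (u * FreeMonoid.of (false, i))) :
    x * term (.aPt μ) = 0 := by
  refine mul_term_eq_zero h fun q => ?_
  have : deriv (true, q.1.2) (normalForm x).1 = μ • deriv (false, q.1.2) (normalForm x).1 := by
    ext u
    simp [h']
  have h2 : letterMulTerm (false, q.1.2) (.aPt μ) = -μ • letterMulTerm (true, q.1.2) (.aPt μ) := by
    simp [letterMulTerm]
  rw [Fintype.sum_bool, this, h2, Finsupp.smul_apply]
  module

/-- An element with nonzero constant term is not a left zero divisor. -/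
theorem eq_zero_of_mul_eq_zero {x r : CedoAlgebra K} (hx : (normalForm x).1.coeff 1 ≠ 0)
    (h : x * r = 0) : r = 0 := by
  have hp : (normalForm x).1 ≠ 0 := by
    intro e
    simp [e] at hx
  rw [← normalForm_eq_zero, normalForm_mul] at h
  rw [← normalForm_eq_zero]
  have h1 : (normalForm r).1 = 0 := by
    have := congrArg Prod.fst h
    rw [act_fst] at this
    exact (mul_eq_zero.1 this).resolve_left hp
  have h2 : (normalForm r).2.1 = 0 := by
    have := congrArg (fun v => v.2.1) h
    simpa [act_snd_fst, h1, hx] using this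
  refine Prod.ext h1 (Prod.ext h2 (Finsupp.ext fun q => ?_))
  have := congrArg (fun v => v.2.2 q) h
  simpa [act_snd_snd, h1, h2, hp] using this

theorem normalForm_of_mul_eq_zero {x r : CedoAlgebra K} (hx : (normalForm x).1 ≠ 0)
    (h : x * r = 0) :
    (normalForm r).1 = 0 ∧ (normalForm r).2.2 = 0 ∧ ∀ q : CedoLetter × CedoTerm K,
      ∑ k : Bool, letterMul (k, q.1.2) (normalForm r).2.1 q •
        deriv (k, q.1.2) (normalForm x).1 = 0 := by
  rw [← normalForm_eq_zero, normalForm_mul] at h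
  have h1 : (normalForm r).1 = 0 := by
    have := congrArg Prod.fst h
    rw [act_fst] at this
    exact (mul_eq_zero.1 this).resolve_left hx
  have h2 (q : CedoLetter × CedoTerm K) : (normalForm x).1 * (normalForm r).2.2 q +
      ∑ k : Bool, letterMul (k, q.1.2) (normalForm r).2.1 q •
        deriv (k, q.1.2) (normalForm x).1 = 0 := by
    have := congrArg (fun v => v.2.2 q) h
    simpa only [act_snd_snd, h1, coeff_zero, Finsupp.coe_zero, Pi.zero_apply, zero_smul,
      add_zero, Prod.snd_zero] using this
  have h3 : (normalForm r).2.2 = 0 := by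
    refine Finsupp.ext fun q => ?_
    by_contra hq
    obtain ⟨u, hu, hu'⟩ := exists_coeff_mul_ne_zero hx hq
    -- `u` is at least as long as every word of the polynomial part of `x`, whereas the derivatives
    -- contain only strictly shorter words; nothing can cancel the coefficient at `u`.
    have hd (k : Bool) : (normalForm x).1.coeff (u * FreeMonoid.of (k, q.1.2)) = 0 := by
      by_contra hk
      simpa using hu' _ hk
    have := congrArg (fun p => p.coeff u) (h2 q)
    simp [hd, hu] at this
  refine ⟨h1, h3, fun q => ?_⟩
  simpa [h3] using h2 q

/-- The last letters of all elements killing a given nonzero combination of terminal generators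
are proportional. -/
theorem exists_line {τ : CedoTerm K →₀ K} (hτ : τ ≠ 0) :
    ∃ α β : K, (α ≠ 0 ∨ β ≠ 0) ∧ ∀ p : CedoPoly K,
      (∀ q : CedoLetter × CedoTerm K,
        ∑ k : Bool, letterMul (k, q.1.2) τ q • deriv (k, q.1.2) p = 0) →
      ∀ u i, α * p.coeff (u * FreeMonoid.of (false, i)) +
        β * p.coeff (u * FreeMonoid.of (true, i)) = 0 := by
  have key {p : CedoPoly K} (h : ∀ q : CedoLetter × CedoTerm K,
      ∑ k : Bool, letterMul (k, q.1.2) τ q • deriv (k, q.1.2) p = 0)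
      (u : FreeMonoid CedoLetter) (k : Bool) (i : ℕ) (t : CedoTerm K) :
      letterMul (false, i) τ ((k, i), t) * p.coeff (u * FreeMonoid.of (false, i)) +
        letterMul (true, i) τ ((k, i), t) * p.coeff (u * FreeMonoid.of (true, i)) = 0 := by
    have := congrArg (fun p => p.coeff u) (h ((k, i), t))
    simpa [add_comm] using this
  obtain ⟨t, ht⟩ := Finsupp.ne_iff.1 hτ
  rw [Finsupp.zero_apply] at ht
  cases t with
  | aInf =>
    refine ⟨1, 0, by simp, fun p h u i => ?_⟩
    have := key h u false i .aInf
    simp only [letterMul_aInf] at this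
    simpa using (mul_eq_zero.1 (by simpa using this)).resolve_left ht
  | aPt μ =>
    refine ⟨-μ, 1, by simp, fun p h u i => ?_⟩
    have := key h u true i (.aPt μ)
    simp only [letterMul_aPt] at this
    refine (mul_eq_zero.1 (?_ : τ (.aPt μ) * _ = 0)).resolve_left ht
    simp only [Bool.false_eq_true, if_true, if_false] at this
    linear_combination this
  | b1 j =>
    -- For `i ≤ j`, `a_{0,i}` sends both `b_{1,j}` and `b_{2,j}` to the same element, while
    -- `a_{1,i}` sends only `b_{1,j}` there.
    refine ⟨τ (.b1 j) + τ (.b2 j), τ (.b1 j), .inr ht, fun p h u i => ?_⟩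
    obtain hij | hij := le_or_gt i j
    · simpa [letterMul_b1_of_le _ hij] using key h u false i (.b1 j)
    -- For `j < i` the two products are independent, so both coefficients of `p` vanish.
    · have h0 := key h u false i (.b1 j)
      have h1 := key h u true i (.b1 j)
      simp only [letterMul_b1_of_lt _ _ hij] at h0 h1
      simp only [if_true, Bool.true_eq_false, Bool.false_eq_true, if_false, zero_mul, zero_add,
        add_zero, mul_eq_zero, ht, false_or] at h0 h1
      simp [h0, h1]
  | b2 j =>
    refine ⟨τ (.b1 j) + τ (.b2 j), τ (.b1 j), ?_, fun p h u i => ?_⟩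
    · by_contra! hc
      exact ht (by simpa [hc.2] using hc.1)
    obtain hij | hij := le_or_gt i j
    · simpa [letterMul_b1_of_le _ hij] using key h u false i (.b1 j)
    · have h0 := key h u false i (.b2 j)
      have h1 := key h u true i (.b2 j)
      simp only [letterMul_b2_of_lt _ _ hij] at h0 h1
      simp only [if_true, Bool.true_eq_false, Bool.false_eq_true, if_false, zero_mul, zero_add,
        add_zero, mul_eq_zero, ht, false_or] at h0 h1
      simp [h0, h1]

/-- If two elements have non-proportional pairs of coefficients of last letters, then they have
no common right annihilator. -/
theorem eq_zero_of_det_ne_zero {x y r : CedoAlgebra K} {u v : FreeMonoid CedoLetter} {i j : ℕ}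
    (hdet : (normalForm x).1.coeff (u * FreeMonoid.of (false, i)) *
        (normalForm y).1.coeff (v * FreeMonoid.of (true, j)) -
      (normalForm x).1.coeff (u * FreeMonoid.of (true, i)) *
        (normalForm y).1.coeff (v * FreeMonoid.of (false, j)) ≠ 0)
    (hx : x * r = 0) (hy : y * r = 0) : r = 0 := by
  have hx0 : (normalForm x).1 ≠ 0 := by
    intro h
    simp [h] at hdet
  have hy0 : (normalForm y).1 ≠ 0 := by
    intro h
    simp [h] at hdet
  obtain ⟨h1, h2, hqx⟩ := normalForm_of_mul_eq_zero hx0 hx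
  obtain ⟨-, -, hqy⟩ := normalForm_of_mul_eq_zero hy0 hy
  rw [← normalForm_eq_zero]
  refine Prod.ext h1 (Prod.ext ?_ h2)
  by_contra hτ
  obtain ⟨α, β, hαβ, hline⟩ := exists_line hτ
  have ex := hline _ hqx u i
  have ey := hline _ hqy v j
  obtain h | h := hαβ
  · refine hdet ((mul_eq_zero.1 (?_ : α * _ = 0)).resolve_left h)
    linear_combination (normalForm y).1.coeff (v * FreeMonoid.of (true, j)) * ex -
      (normalForm x).1.coeff (u * FreeMonoid.of (true, i)) * ey
  · refine hdet ((mul_eq_zero.1 (?_ : β * _ = 0)).resolve_left h)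
    linear_combination (normalForm x).1.coeff (u * FreeMonoid.of (false, i)) * ey -
      (normalForm y).1.coeff (v * FreeMonoid.of (false, j)) * ex

theorem rightAnn_eq_singleton_zero {R : Type*} [Ring R] {X : Set R}
    (h : ∀ r, (∀ x ∈ X, x * r = 0) → r = 0) : rightAnn X = {0} :=
  Set.Subset.antisymm (fun r hr => h r hr) (by rintro _ rfl x _; exact mul_zero x)

/-- Cedó's algebra is right zip. -/
theorem isRightZip (K : Type*) [Field K] : IsRightZip (CedoAlgebra K) := by
  intro X hX
  have hX' (t : CedoTerm K) : ∃ x ∈ X, x * term t ≠ 0 := by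
    by_contra! h
    have : term t ∈ rightAnn X := h
    rw [hX] at this
    exact term_ne_zero t this
  by_cases h0 : ∃ x ∈ X, (normalForm x).1.coeff 1 ≠ 0
  · obtain ⟨x, hx, h⟩ := h0
    exact ⟨{x}, by simpa using hx, Set.finite_singleton x,
      rightAnn_eq_singleton_zero fun r hr => eq_zero_of_mul_eq_zero h (hr x rfl)⟩
  push Not at h0
  -- Otherwise `a_∞` would annihilate all of `X`.
  obtain ⟨x, hx, u, i, hxu⟩ : ∃ x ∈ X, ∃ u i,
      (normalForm x).1.coeff (u * FreeMonoid.of (false, i)) ≠ 0 := by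
    by_contra! h
    obtain ⟨x, hx, hxt⟩ := hX' .aInf
    exact hxt (mul_aInf_eq_zero (h0 x hx) (h x hx))
  set μ := (normalForm x).1.coeff (u * FreeMonoid.of (true, i)) /
    (normalForm x).1.coeff (u * FreeMonoid.of (false, i)) with hμ
  -- The slope `μ` is that of the pair found in `x`; were all pairs on this line, `a_μ` would
  -- annihilate `X`.
  obtain ⟨y, hy, v, j, hyv⟩ : ∃ y ∈ X, ∃ v j,
      (normalForm y).1.coeff (v * FreeMonoid.of (true, j)) ≠
        μ * (normalForm y).1.coeff (v * FreeMonoid.of (false, j)) := by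
    by_contra! h
    obtain ⟨x, hx, hxt⟩ := hX' (.aPt μ)
    exact hxt (mul_aPt_eq_zero (h0 x hx) (h x hx))
  refine ⟨{x, y}, ?_, Set.toFinite _, rightAnn_eq_singleton_zero fun r hr =>
    eq_zero_of_det_ne_zero (u := u) (v := v) (i := i) (j := j) (fun hdet => hyv ?_)
      (hr x (by simp)) (hr y (by simp))⟩
  · rintro z (rfl | rfl) <;> assumption
  · rw [hμ]
    field_simp
    linear_combination hdet

/-! ### The power series ring. -/

theorem coeff_zero_witness_mul (i : ℕ) (f : PowerSeries (CedoAlgebra K)) :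
    PowerSeries.coeff 0 ((PowerSeries.C (gen K (.a0 i)) -
      PowerSeries.C (gen K (.a1 i)) * PowerSeries.X) * f) =
      letter (false, i) * PowerSeries.coeff 0 f := by
  simp [letter]

theorem coeff_succ_witness_mul (i n : ℕ) (f : PowerSeries (CedoAlgebra K)) :
    PowerSeries.coeff (n + 1) ((PowerSeries.C (gen K (.a0 i)) -
      PowerSeries.C (gen K (.a1 i)) * PowerSeries.X) * f) =
      letter (false, i) * PowerSeries.coeff (n + 1) f -
        letter (true, i) * PowerSeries.coeff n f := by
  rw [sub_mul, mul_assoc, map_sub, PowerSeries.coeff_C_mul, PowerSeries.coeff_C_mul,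
    PowerSeries.coeff_succ_X_mul]
  rfl

/-- The letters act by left multiplication injectively on the polynomial parts. -/
theorem normalForm_of_letter_mul_eq {x y : CedoAlgebra K} {i : ℕ}
    (h : letter (false, i) * x = letter (true, i) * y) (hy : (normalForm y).1 = 0)
    (hy' : (normalForm y).2.2 = 0) : (normalForm x).1 = 0 ∧ (normalForm x).2.2 = 0 ∧
      letterMul (false, i) (normalForm x).2.1 = letterMul (true, i) (normalForm y).2.1 := by
  have h := congrArg normalForm h
  simp only [normalForm_letter_mul] at h
  have h1 := congrArg (fun v => v.1) h
  have h2 (q) := congrArg (fun v => v.2.2 q) h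
  simp only [letterOp_fst, letterOp_snd_snd, hy, hy', mul_zero, Finsupp.coe_zero,
    Pi.zero_apply, zero_add] at h1 h2
  have h3 (q) : (normalForm x).2.2 q = 0 := by
    ext w
    -- Letter-terminal products sit at the empty word, so nonempty words isolate the part of `x`
    -- ending in a letter-terminal pair.
    have := congrArg (fun p => p.coeff (FreeMonoid.of (false, i) * w)) (h2 q)
    have hw : (FreeMonoid.of (false, i) * w : FreeMonoid CedoLetter) ≠ 1 := List.cons_ne_nil _ _
    simpa [hw] using this
  refine ⟨?_, Finsupp.ext h3, Finsupp.ext fun q => ?_⟩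
  · ext w
    have := congrArg (fun p => p.coeff (FreeMonoid.of (false, i) * w)) h1
    simpa using this
  · have := congrArg (fun p => p.coeff 1) (h2 q)
    simpa [h3] using this

theorem rightAnn_cedoWitness (K : Type*) [Field K] : rightAnn (cedoWitness K) = {0} := by
  refine rightAnn_eq_singleton_zero fun f hf => ?_
  -- The factor `0` plays the role of a coefficient in degree `-1`, giving the base case the shape
  -- of the recursion.
  have h0 (i : ℕ) : letter (false, i) * PowerSeries.coeff 0 f = letter (true, i) * 0 := by
    rw [← coeff_zero_witness_mul, hf _ ⟨i, rfl⟩]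
    simp
  have hS (i n : ℕ) : letter (false, i) * PowerSeries.coeff (n + 1) f =
      letter (true, i) * PowerSeries.coeff n f := by
    rw [← sub_eq_zero, ← coeff_succ_witness_mul, hf _ ⟨i, rfl⟩, map_zero]
  have hp (n : ℕ) : (normalForm (PowerSeries.coeff n f)).1 = 0 ∧
      (normalForm (PowerSeries.coeff n f)).2.2 = 0 := by
    induction n with
    | zero =>
      obtain ⟨h1, h2, -⟩ := normalForm_of_letter_mul_eq (h0 0) (by simp) (by simp)
      exact ⟨h1, h2⟩
    | succ n ih =>
      obtain ⟨h1, h2, -⟩ := normalForm_of_letter_mul_eq (hS 0 n) ih.1 ih.2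
      exact ⟨h1, h2⟩
  set τ : ℕ → CedoTerm K →₀ K := fun n => (normalForm (PowerSeries.coeff n f)).2.1 with hτ
  have h0 (i : ℕ) : letterMul (false, i) (τ 0) = 0 :=
    (normalForm_of_letter_mul_eq (h0 i) (by simp) (by simp)).2.2.trans (by simp)
  have hS (i n : ℕ) : letterMul (false, i) (τ (n + 1)) = letterMul (true, i) (τ n) :=
    (normalForm_of_letter_mul_eq (hS i n) (hp n).1 (hp n).2).2.2
  have hτ0 (n : ℕ) : τ n = 0 := by
    ext t
    cases t with
    | aInf =>
      cases n with
      | zero => simpa [letterMul_aInf] using DFunLike.congr_fun (h0 0) ((false, 0), .aInf)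
      | succ n => simpa [letterMul_aInf] using DFunLike.congr_fun (hS 0 n) ((false, 0), .aInf)
    | aPt μ =>
      have e0 := DFunLike.congr_fun (h0 0) ((true, 0), .aPt μ)
      have eS (n) := DFunLike.congr_fun (hS 0 n) ((true, 0), .aPt μ)
      simp only [letterMul_aPt, Bool.false_eq_true, if_true, if_false] at e0 eS
      -- The recursion reads `-μ τ_{n+1} = τ_n`: for `μ = 0` it gives `τ_n = 0` at once, otherwise
      -- induction starts from `-μ τ_0 = 0`.
      by_cases hμ : μ = 0
      · simpa [hμ] using (eS n).symm
      · induction n with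
        | zero => simpa [hμ] using e0
        | succ n ih => simpa [hμ, ih] using eS n
    | b1 j =>
      -- The index `j + 1` lies outside the relations, so `a_{0,j+1}b_{1,j}` is independent of every
      -- `a_{1,j+1}t`.
      have := j.lt_succ_self
      cases n with
      | zero => simpa [letterMul_b1_of_lt _ _ this] using
          DFunLike.congr_fun (h0 (j + 1)) ((false, j + 1), .b1 j)
      | succ n => simpa [letterMul_b1_of_lt _ _ this] using
          DFunLike.congr_fun (hS (j + 1) n) ((false, j + 1), .b1 j)
    | b2 j =>
      have := j.lt_succ_self
      cases n with
      | zero => simpa [letterMul_b2_of_lt _ _ this] using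
          DFunLike.congr_fun (h0 (j + 1)) ((false, j + 1), .b2 j)
      | succ n => simpa [letterMul_b2_of_lt _ _ this] using
          DFunLike.congr_fun (hS (j + 1) n) ((false, j + 1), .b2 j)
  ext n
  rw [map_zero, ← normalForm_eq_zero]
  exact Prod.ext (hp n).1 (Prod.ext (hτ0 n) (hp n).2)

/-- The power series `(b_{1,n} - b_{2,n}) + b_{2,n} x` is annihilated by `a_{0,i} - a_{1,i} x` for
`i ≤ n`. -/
theorem witness_mul_eq_zero {i n : ℕ} (h : i ≤ n) :
    (PowerSeries.C (gen K (.a0 i)) - PowerSeries.C (gen K (.a1 i)) * PowerSeries.X) *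
      (PowerSeries.C (term (.b1 n) - term (.b2 n)) + PowerSeries.C (term (.b2 n)) * PowerSeries.X) =
      0 := by
  have e1 : letter (K := K) (false, i) * term (.b1 n) = letter (false, i) * term (.b2 n) := by
    rw [letter_mul_term _ (CedoTerm.b1 n), letter_mul_term _ (CedoTerm.b2 n)]
    simp [letterMulTerm, h]
  have e2 : letter (K := K) (false, i) * term (.b2 n) = letter (true, i) * term (.b1 n) := by
    rw [letter_mul_term _ (CedoTerm.b1 n), letter_mul_term _ (CedoTerm.b2 n)]
    simp [letterMulTerm, h]
  have e3 : letter (K := K) (true, i) * term (.b2 n) = 0 := by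
    rw [letter_mul_term]
    simp [letterMulTerm, h]
  ext m
  cases m with
  | zero => rw [coeff_zero_witness_mul]; simp [mul_sub, e1]
  | succ m =>
    rw [coeff_succ_witness_mul]
    cases m with
    | zero => simp [PowerSeries.coeff_C, mul_sub, e2, e3]
    | succ m =>
      cases m <;> simp [PowerSeries.coeff_C, PowerSeries.coeff_succ_mul_X, e3]

theorem rightAnn_ne_of_finite {F : Set (PowerSeries (CedoAlgebra K))} (hF : F ⊆ cedoWitness K)
    (hfin : F.Finite) : rightAnn F ≠ {0} := by
  rw [cedoWitness, ← Set.image_univ] at hF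
  obtain ⟨I, -, hI, rfl⟩ := hfin.exists_subset_finite_image_eq hF
  obtain ⟨n, hn⟩ := hI.bddAbove
  intro h
  have hmem : PowerSeries.C (term (K := K) (.b1 n) - term (.b2 n)) +
      PowerSeries.C (term (.b2 n)) * PowerSeries.X ∈ ({0} : Set (PowerSeries _)) := by
    rw [← h]
    rintro _ ⟨i, hi, rfl⟩
    exact witness_mul_eq_zero (hn hi)
  -- The coefficient of `x` is `b_{2,n}`, which is nonzero.
  have := congrArg (PowerSeries.coeff 1) (Set.mem_singleton_iff.1 hmem)
  exact term_ne_zero (K := K) (.b2 n) (by simpa [PowerSeries.coeff_C] using this)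

end CedoAlgebra

theorem mainTheorem5 (K : Type*) [Field K] :
    IsRightZip (CedoAlgebra K) ∧
    rightAnn (cedoWitness K) = {0} ∧
    (∀ F : Set (PowerSeries (CedoAlgebra K)), F ⊆ cedoWitness K → F.Finite →
      rightAnn F ≠ {0}) ∧
    ¬ IsRightZip (PowerSeries (CedoAlgebra K)) := by
  refine ⟨CedoAlgebra.isRightZip K, CedoAlgebra.rightAnn_cedoWitness K,
    fun F hF hfin => CedoAlgebra.rightAnn_ne_of_finite hF hfin, fun h => ?_⟩
  obtain ⟨F, hF, hfin, h0⟩ := h _ (CedoAlgebra.rightAnn_cedoWitness K)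
  exact CedoAlgebra.rightAnn_ne_of_finite hF hfin h0
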